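/- Let $n\ge 2$, write points of $\mathbb{R}^n$ as $(x,y)$ with $x\in\mathbb{R}^{n-1}$, $y\in\mathbb{R}$, and set $B_1=\{|(x,y)|<1\}$, $B_1^+=B_1\cap\{y>0\}$, $B_1'=B_1\cap\{y=0\}$, $(\partial B_1)^+=\partial B_1\cap\{y>0\}$. Let $0<\alpha\le 1$ and let $\varphi\in C^{2,\alpha}(\overline{B_1})$ be strictly positive on $\partial B_1\cap\{y=0\}$. A family $(\beta_\epsilon)_{\epsilon>0}$ of functions $\beta_\epsilon:\mathbb{R}\to\mathbb{R}$ is an admissible penalization if, for every $\epsilon>0$, $\beta_\epsilon$ is Lipschitz on $\mathbb{R}$, nonpositive, zero on $[0,\infty)$, nondecreasing and concave; for example $\beta_\epsilon(t)=\min(t,0)/\epsilon$. There is a constant $C<\infty$, depending only on $n$ and $\varphi$ (in particular not on $\epsilon$), such that for every admissible penalization, every $\epsilon>0$ and every classical solution $u^\epsilon$ of $$\Delta u^\epsilon=0\ \text{ in } B_1^+,\qquad u^\epsilon_y=\beta_\epsilon(u^\epsilon)\ \text{ on } B_1',\qquad u^\epsilon=\varphi\ \text{ on } (\partial B_1)^+,$$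 extended to $B_1$ by even reflection in $y$, one has $$\|u^\epsilon_y\|_{L^\infty(B_1)}\le C.$$ Here a classical solution is a function that is continuous on $\overline{B_1^+}$ and harmonic in $B_1^+$, takes the values $\varphi$ on $(\partial B_1)^+$, and whose derivative $u^\epsilon_y$ in $B_1^+$ tends to $\beta_\epsilon(u^\epsilon(x_0,0))$ at every point $(x_0,0)\in B_1'$. -/

import Mathlib

open Set Filter Topology MeasureTheory Metric
open scoped NNReal ENNReal

namespace PenalizedObstacle

/-- The ambient space `ℝⁿ = ℝⁿ⁻¹ × ℝ` with `n = d + 1`. A point is written `(x, y)`; the last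
coordinate is `y`. -/
abbrev Space (d : ℕ) : Type := EuclideanSpace ℝ (Fin (d + 1))

/-- The `y`-coordinate of a point. -/
def height {d : ℕ} (z : Space d) : ℝ := z (Fin.last d)

/-- The unit vector in the `y`-direction. -/
noncomputable def ey (d : ℕ) : Space d := EuclideanSpace.single (Fin.last d) 1

/-- The derivative `u_y` in the `y`-direction. -/
noncomputable def dy {d : ℕ} (u : Space d → ℝ) (z : Space d) : ℝ := lineDeriv ℝ u z (ey d)

/-- The open upper half ball `B₁⁺`. -/
def upperHalfBall (d : ℕ) : Set (Space d) := {z | z ∈ ball (0 : Space d) 1 ∧ 0 < height z}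

/-- The closed upper half ball. -/
def closedUpperHalfBall (d : ℕ) : Set (Space d) :=
  {z | z ∈ closedBall (0 : Space d) 1 ∧ 0 ≤ height z}

/-- The flat part `B₁'` of the boundary, an open ball of `ℝⁿ⁻¹ × {0}`. -/
def flatBall (d : ℕ) : Set (Space d) := {z | z ∈ ball (0 : Space d) 1 ∧ height z = 0}

/-- The spherical part `(∂B₁)⁺` of the boundary. -/
def upperCap (d : ℕ) : Set (Space d) := {z | z ∈ sphere (0 : Space d) 1 ∧ 0 < height z}

/-- The equator `∂B₁ ∩ {y = 0}`. -/
def equator (d : ℕ) : Set (Space d) := {z | z ∈ sphere (0 : Space d) 1 ∧ height z = 0}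

/-- The Hölder class `C^{2,α}` on the closed unit ball. -/
def IsC2Alpha {d : ℕ} (α : ℝ≥0) (φ : Space d → ℝ) : Prop :=
  ContDiffOn ℝ 2 φ (closedBall 0 1) ∧
    ∃ K : ℝ≥0, HolderOnWith K α
      (iteratedFDerivWithin ℝ 2 φ (closedBall 0 1)) (closedBall 0 1)

/-- Admissible penalization families `β_ε`, `ε > 0`. The conditions `β_ε' ≥ 0` and `β_ε'' ≤ 0` are
read as monotonicity and concavity, so that the model family `β_ε(t) = min(t, 0) / ε`, which has a
corner at `0`, is included. The Lipschitz constant may depend on `ε`. -/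
structure IsAdmissiblePenalization (β : ℝ → ℝ → ℝ) : Prop where
  lipschitz : ∀ ε > 0, ∃ K : ℝ≥0, LipschitzWith K (β ε)
  nonpos : ∀ ε > 0, ∀ t, β ε t ≤ 0
  eq_zero : ∀ ε > 0, ∀ t, 0 ≤ t → β ε t = 0
  monotone : ∀ ε > 0, Monotone (β ε)
  concave : ∀ ε > 0, ConcaveOn ℝ univ (β ε)

/-- `u` is a classical solution of `Δu = 0` in `B₁⁺`, `u_y = b(u)` on `B₁'`, `u = φ` on `(∂B₁)⁺`:
it is continuous up to the boundary, and `u_y` attains its values on `B₁'` continuously from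
inside. -/
structure IsSolution {d : ℕ} (φ : Space d → ℝ) (b : ℝ → ℝ) (u : Space d → ℝ) : Prop where
  continuousOn : ContinuousOn u (closedUpperHalfBall d)
  harmonic : InnerProductSpace.HarmonicOnNhd u (upperHalfBall d)
  neumann : ∀ z ∈ flatBall d, Tendsto (dy u) (𝓝[upperHalfBall d] z) (𝓝 (b (u z)))
  dirichlet : ∀ z ∈ upperCap d, u z = φ z

/-- The even reflection in `y`: `(x, y) ↦ u (x, |y|)`. -/
noncomputable def evenReflection {d : ℕ} (u : Space d → ℝ) (z : Space d) : ℝ :=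
  u (z + (|height z| - height z) • ey d)

end PenalizedObstacle

open PenalizedObstacle

namespace PenalizedObstacle

variable {d : ℕ}

/-! The estimate has three layers, each a comparison by the maximum principle with constants
depending only on `φ` and the dimension. First, the penalization is bounded (`neg_le_penalization`).
At a flat minimum `w` of `u` with `u w < 0`, positivity of `φ` on the equator puts `w` inside the
flat ball, and the linear function `u w - K y` lies below `u`. Its slope at `w` gives `b (u w) ≥
-K`, and monotonicity spreads this over the flat ball. Next, `u` leaves its spherical data at most
linearly along vertical segments (`abs_sub_le_barrier`): a family of quadratic barriers indexed by
`r` dominates `|u - φ|`, and choosing `r` as the height of the sphere above the point turns the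
barrier into vertical distance. Finally, `u_y` is bounded through symmetric vertical differences of
the even reflection, which need no regularity of `u_y` up to the sphere. The difference with step
`t` lives on a lens: it vanishes on the flat side, is `O(t)` on the spherical side by the barrier,
and is harmonic except across `y = t`, where the reflected term has a kink of size at most `2K`. A
corrector of size `O(t)` excludes interior maxima (`not_isMaxOn_correctedDiff`). Dividing by `2t`
and letting `t → 0` yields the constant `A + 2K + 2L`, with `L` a Lipschitz bound for `φ` and `A` a
bound for its Laplacian. -/

/-! ### Vertical coordinate, reflection and fold. -/

theorem height_add (z w : Space d) : height (z + w) = height z + height w := rfl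

theorem height_sub (z w : Space d) : height (z - w) = height z - height w := rfl

theorem height_smul (s : ℝ) (z : Space d) : height (s • z) = s * height z := rfl

theorem height_ey : height (ey d) = 1 := by simp [height, ey]

theorem norm_ey : ‖ey d‖ = 1 := by simp [ey]

theorem height_add_smul_ey (z : Space d) (s : ℝ) : height (z + s • ey d) = height z + s := by
  rw [height_add, height_smul, height_ey, mul_one]

theorem height_sub_smul_ey (z : Space d) (s : ℝ) : height (z - s • ey d) = height z - s := by
  rw [height_sub, height_smul, height_ey, mul_one]

theorem continuous_height : Continuous (height : Space d → ℝ) := by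
  unfold height; fun_prop

theorem inner_ey (z : Space d) : inner ℝ z (ey d) = height z := by
  simp [ey, height, EuclideanSpace.inner_single_right]

theorem norm_sq_add_smul_ey (z : Space d) (s : ℝ) :
    ‖z + s • ey d‖ ^ 2 = ‖z‖ ^ 2 + 2 * s * height z + s ^ 2 := by
  rw [norm_add_sq_real, inner_smul_right, inner_ey, norm_smul, norm_ey, mul_one,
    Real.norm_eq_abs, sq_abs]
  ring

theorem norm_sq_sub_smul_ey (z : Space d) (s : ℝ) :
    ‖z - s • ey d‖ ^ 2 = ‖z‖ ^ 2 - 2 * s * height z + s ^ 2 := by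
  have := norm_sq_add_smul_ey z (-s)
  rw [neg_smul, ← sub_eq_add_neg] at this
  rw [this]; ring

theorem height_le_norm (z : Space d) : |height z| ≤ ‖z‖ := by
  have := abs_real_inner_le_norm z (ey d)
  rwa [inner_ey, norm_ey, mul_one] at this

theorem mem_closedBall_zero_iff_sq {z : Space d} :
    z ∈ closedBall (0 : Space d) 1 ↔ ‖z‖ ^ 2 ≤ 1 := by
  rw [mem_closedBall_zero_iff, sq_le_one_iff₀ (norm_nonneg z)]

theorem mem_ball_zero_iff_sq {z : Space d} : z ∈ ball (0 : Space d) 1 ↔ ‖z‖ ^ 2 < 1 := by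
  rw [mem_ball_zero_iff, sq_lt_one_iff₀ (norm_nonneg z)]

theorem isCompact_closedUpperHalfBall : IsCompact (closedUpperHalfBall d) :=
  (isCompact_closedBall 0 1).inter_right (isClosed_le continuous_const continuous_height)

theorem isOpen_upperHalfBall : IsOpen (upperHalfBall d) :=
  isOpen_ball.inter (isOpen_lt continuous_const continuous_height)

theorem upperHalfBall_subset : upperHalfBall d ⊆ closedUpperHalfBall d :=
  fun _ hz => ⟨ball_subset_closedBall hz.1, hz.2.le⟩

theorem flatBall_subset : flatBall d ⊆ closedUpperHalfBall d :=
  fun _ hz => ⟨ball_subset_closedBall hz.1, hz.2.ge⟩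

/-- The reflection `(x, y) ↦ (x, -y)`. -/
noncomputable def flip (z : Space d) : Space d := z - (2 * height z) • ey d

theorem flip_add_smul (z v : Space d) (s : ℝ) : flip (z + s • v) = flip z + s • flip v := by
  simp only [flip, height_add, height_smul]
  module

theorem flip_flip (z : Space d) : flip (flip z) = z := by
  simp only [flip, height_sub_smul_ey]
  module

theorem height_flip (z : Space d) : height (flip z) = -height z := by
  rw [flip, height_sub_smul_ey]; ring

theorem norm_sq_flip (z : Space d) : ‖flip z‖ ^ 2 = ‖z‖ ^ 2 := by
  rw [flip, norm_sq_sub_smul_ey]; ring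

theorem flip_ey : flip (ey d) = -ey d := by
  rw [flip, height_ey]; module

theorem flip_single (i : Fin (d + 1)) :
    flip (EuclideanSpace.single i (1 : ℝ) : Space d) = EuclideanSpace.single i 1 ∨
      flip (EuclideanSpace.single i (1 : ℝ) : Space d) = -EuclideanSpace.single i 1 := by
  by_cases h : i = Fin.last d
  · right; subst h; exact flip_ey
  · left
    have : height (EuclideanSpace.single i (1 : ℝ) : Space d) = 0 := by
      simp [height, Ne.symm h]
    simp [flip, this]

/-- The fold `(x, y) ↦ (x, |y|)`. -/
noncomputable def fold (z : Space d) : Space d := z + (|height z| - height z) • ey d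

theorem continuous_fold : Continuous (fold : Space d → Space d) :=
  continuous_id.add ((continuous_height.abs.sub continuous_height).smul continuous_const)

theorem height_fold (z : Space d) : height (fold z) = |height z| := by
  rw [fold, height_add_smul_ey]; ring

theorem norm_sq_fold (z : Space d) : ‖fold z‖ ^ 2 = ‖z‖ ^ 2 := by
  rw [fold, norm_sq_add_smul_ey]
  linear_combination sq_abs (height z)

theorem fold_of_nonneg {z : Space d} (h : 0 ≤ height z) : fold z = z := by
  simp [fold, abs_of_nonneg h]

theorem fold_of_nonpos {z : Space d} (h : height z ≤ 0) : fold z = flip z := by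
  rw [fold, flip, abs_of_nonpos h]; module

theorem fold_flip (z : Space d) : fold (flip z) = fold z := by
  rcases le_total 0 (height z) with h | h
  · rw [fold_of_nonneg h, fold_of_nonpos (by rw [height_flip]; linarith), flip_flip]
  · rw [fold_of_nonpos h, fold_of_nonneg (by rw [height_flip]; linarith)]

theorem evenReflection_eq (u : Space d → ℝ) (z : Space d) :
    evenReflection u z = u (fold z) := rfl

/-! ### The Laplacian through second differences. -/

/-- The symmetric second difference of `f` at `z` with increment `v`. -/
def secondDiff (f : Space d → ℝ) (z v : Space d) : ℝ := f (z + v) + f (z - v) - 2 * f z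

/-- `f` has Laplacian `L` at `z` in the sense of second differences along the coordinate axes. -/
def HasPointLaplacian (f : Space d → ℝ) (z : Space d) (L : ℝ) : Prop :=
  Tendsto (fun s : ℝ => (∑ i, secondDiff f z (s • EuclideanSpace.single i (1 : ℝ))) / s ^ 2)
    (𝓝[>] 0) (𝓝 L)

/-- One application of l'Hôpital leaves `(g' s - g' (-s)) / (2 s)`, which converges by
differentiability of `g'` at `0` alone. -/
theorem tendsto_secondDiff_real {g g' : ℝ → ℝ} {A : ℝ}
    (hg : ∀ᶠ s in 𝓝 0, HasDerivAt g (g' s) s) (hg' : HasDerivAt g' A 0) :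
    Tendsto (fun s => (g s + g (-s) - 2 * g 0) / s ^ 2) (𝓝[>] 0) (𝓝 A) := by
  have hneg : Tendsto (fun s : ℝ => -s) (𝓝 0) (𝓝 0) := by
    simpa using continuous_neg.tendsto (0 : ℝ)
  have hc : ContinuousAt g 0 := hg.self_of_nhds.continuousAt
  refine HasDerivAt.lhopital_zero_nhdsGT (f' := fun s => g' s - g' (-s)) (g' := fun s => 2 * s)
    ?_ ?_ ?_ ?_ ?_ ?_
  · refine nhdsWithin_le_nhds ?_
    filter_upwards [hg, hneg.eventually hg] with s h1 h2
    have h3 : HasDerivAt (fun s => g (-s)) (-g' (-s)) s := by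
      have h4 := h2.comp s (hasDerivAt_neg s)
      rw [mul_neg_one] at h4
      exact h4
    exact (h1.add h3).sub_const (2 * g 0)
  · exact Eventually.of_forall fun s => by simpa using hasDerivAt_pow 2 s
  · filter_upwards [self_mem_nhdsWithin] with s hs
    exact mul_ne_zero two_ne_zero (ne_of_gt hs)
  · have h1 := (hc.tendsto.add (hc.tendsto.comp hneg)).sub_const (2 * g 0)
    rw [show g 0 + g 0 - 2 * g 0 = 0 by ring] at h1
    exact h1.mono_left nhdsWithin_le_nhds
  · have : Continuous fun s : ℝ => s ^ 2 := by fun_prop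
    simpa using (this.tendsto 0).mono_left nhdsWithin_le_nhds
  · have h3 : HasDerivAt (fun s => g' (-s)) (-A) 0 := by
      have h4 : HasDerivAt g' A (-0) := by rwa [neg_zero]
      have h5 := h4.comp (0 : ℝ) (hasDerivAt_neg (0 : ℝ))
      rw [mul_neg_one] at h5
      exact h5
    have h := (hasDerivAt_iff_tendsto_slope.1 (hg'.sub h3)).mono_left
      (nhdsWithin_mono 0 fun s (hs : 0 < s) => ne_of_gt hs)
    have h' := h.div_const 2
    rw [show (A - -A) / 2 = A by ring] at h'
    refine h'.congr' ?_
    filter_upwards [self_mem_nhdsWithin] with s hs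
    have hs' : s ≠ 0 := ne_of_gt hs
    simp only [slope_def_field, Pi.sub_apply, neg_zero, sub_self, sub_zero]
    field_simp

theorem tendsto_secondDiff {f : Space d → ℝ} {z : Space d} (hf : ContDiffAt ℝ 2 f z)
    (v : Space d) :
    Tendsto (fun s : ℝ => secondDiff f z (s • v) / s ^ 2) (𝓝[>] 0)
      (𝓝 (iteratedFDeriv ℝ 2 f z ![v, v])) := by
  have hline : ∀ s : ℝ, HasDerivAt (fun s : ℝ => z + s • v) v s := fun s => by
    simpa using ((hasDerivAt_id s).smul_const v).const_add z
  have hlim : Tendsto (fun s : ℝ => z + s • v) (𝓝 0) (𝓝 z) := by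
    simpa using (hline 0).continuousAt.tendsto
  have hd : ∀ᶠ s : ℝ in 𝓝 0,
      HasDerivAt (fun s : ℝ => f (z + s • v)) (fderiv ℝ f (z + s • v) v) s := by
    refine (hlim.eventually ((hf.eventually (by simp)).mono fun w hw =>
      hw.differentiableAt (by norm_num))).mono fun s hs => ?_
    exact HasFDerivAt.comp_hasDerivAt s hs.hasFDerivAt (hline s)
  have hd2 : HasDerivAt (fun s : ℝ => fderiv ℝ f (z + s • v) v)
      (fderiv ℝ (fderiv ℝ f) z v v) 0 := by
    have h2 : HasFDerivAt (fderiv ℝ f) (fderiv ℝ (fderiv ℝ f) z) (z + (0 : ℝ) • v) := by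
      rw [zero_smul, add_zero]
      exact ((hf.fderiv_right (m := 1) (by norm_num)).differentiableAt (by norm_num)).hasFDerivAt
    have h3 : HasDerivAt (fun s : ℝ => fderiv ℝ f (z + s • v)) (fderiv ℝ (fderiv ℝ f) z v) 0 :=
      HasFDerivAt.comp_hasDerivAt (0 : ℝ) h2 (hline 0)
    simpa using h3.clm_apply (hasDerivAt_const (0 : ℝ) v)
  rw [iteratedFDeriv_two_apply]
  refine (tendsto_secondDiff_real hd hd2).congr fun s => ?_
  simp [secondDiff, sub_eq_add_neg]

namespace HasPointLaplacian

variable {f g : Space d → ℝ} {z : Space d} {L M : ℝ}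

theorem add (hf : HasPointLaplacian f z L) (hg : HasPointLaplacian g z M) :
    HasPointLaplacian (fun w => f w + g w) z (L + M) := by
  refine (Tendsto.add hf hg).congr fun s => ?_
  rw [← add_div, ← Finset.sum_add_distrib]
  congr 1
  exact Finset.sum_congr rfl fun i _ => by unfold secondDiff; ring

theorem const_mul (hf : HasPointLaplacian f z L) (c : ℝ) :
    HasPointLaplacian (fun w => c * f w) z (c * L) := by
  refine (Tendsto.const_mul c hf).congr fun s => ?_
  rw [← mul_div_assoc, Finset.mul_sum]
  congr 1
  exact Finset.sum_congr rfl fun i _ => by unfold secondDiff; ring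

theorem comp_add_right (w : Space d) (hf : HasPointLaplacian f (z + w) L) :
    HasPointLaplacian (fun x => f (x + w)) z L := by
  refine Tendsto.congr (fun s => ?_) hf
  congr 1
  refine Finset.sum_congr rfl fun i _ => ?_
  unfold secondDiff
  simp only [add_right_comm z w, add_sub_right_comm z w]

theorem comp_flip (hf : HasPointLaplacian f (flip z) L) :
    HasPointLaplacian (fun x => f (flip x)) z L := by
  refine Tendsto.congr (fun s => ?_) hf
  congr 1
  refine Finset.sum_congr rfl fun i _ => ?_
  unfold secondDiff
  simp only [sub_eq_add_neg _ (s • _), ← neg_smul, flip_add_smul]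
  rcases flip_single i with h | h
  · rw [h]
  · rw [h]; simp [add_comm]

theorem congr (hf : HasPointLaplacian f z L) (h : f =ᶠ[𝓝 z] g) : HasPointLaplacian g z L := by
  refine Tendsto.congr' ?_ hf
  -- The factor `c` is used only for `c = 1` and `c = -1`, to reach both points of the second
  -- difference.
  have hl : ∀ i : Fin (d + 1), ∀ c : ℝ, ∀ᶠ s : ℝ in 𝓝 0,
      f (z + (c * s) • EuclideanSpace.single i (1 : ℝ)) =
        g (z + (c * s) • EuclideanSpace.single i (1 : ℝ)) := fun i c => by
    have hc : Continuous fun s : ℝ =>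
        z + (c * s) • (EuclideanSpace.single i (1 : ℝ) : Space d) := by fun_prop
    have := hc.tendsto 0
    simp only [mul_zero, zero_smul, add_zero] at this
    exact this.eventually h
  filter_upwards [nhdsWithin_le_nhds (eventually_all.2 fun i => hl i 1),
    nhdsWithin_le_nhds (eventually_all.2 fun i => hl i (-1))] with s h1 h2
  congr 1
  refine Finset.sum_congr rfl fun i _ => ?_
  have h1 := h1 i
  have h2 := h2 i
  rw [one_mul] at h1
  rw [neg_one_mul, neg_smul, ← sub_eq_add_neg] at h2
  rw [secondDiff, secondDiff, h1, h2, h.self_of_nhds]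

theorem of_contDiffAt (hf : ContDiffAt ℝ 2 f z) :
    HasPointLaplacian f z (Laplacian.laplacian f z) := by
  rw [InnerProductSpace.laplacian_eq_iteratedFDeriv_orthonormalBasis f
    (EuclideanSpace.basisFun (Fin (d + 1)) ℝ)]
  unfold HasPointLaplacian
  simp only [Finset.sum_div]
  refine tendsto_finsetSum _ fun i _ => ?_
  simpa using tendsto_secondDiff hf (EuclideanSpace.single i (1 : ℝ))

theorem of_harmonicAt (hf : InnerProductSpace.HarmonicAt f z) : HasPointLaplacian f z 0 := by
  have := of_contDiffAt hf.1
  rwa [hf.2.self_of_nhds] at this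

theorem norm_sq (z : Space d) : HasPointLaplacian (fun w => ‖w‖ ^ 2) z (2 * (d + 1)) := by
  refine Tendsto.congr' ?_ tendsto_const_nhds
  filter_upwards [self_mem_nhdsWithin] with s hs
  have hs' : s ≠ 0 := ne_of_gt hs
  have : ∀ i : Fin (d + 1), secondDiff (fun w : Space d => ‖w‖ ^ 2) z
      (s • EuclideanSpace.single i (1 : ℝ)) = 2 * s ^ 2 := fun i => by
    have h := parallelogram_law_with_norm ℝ z (s • (EuclideanSpace.single i (1 : ℝ) : Space d))
    have h2 : ‖s • (EuclideanSpace.single i (1 : ℝ) : Space d)‖ = |s| := by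
      simp [norm_smul]
    rw [h2] at h
    unfold secondDiff
    linear_combination h + 2 * abs_mul_abs_self s
  simp only [this, Finset.sum_const, Finset.card_univ, Fintype.card_fin, nsmul_eq_mul]
  push_cast
  field_simp

theorem of_height {h : ℝ → ℝ} (hh : Tendsto
    (fun s => (h (height z + s) + h (height z - s) - 2 * h (height z)) / s ^ 2) (𝓝[>] 0) (𝓝 L)) :
    HasPointLaplacian (fun w => h (height w)) z L := by
  refine hh.congr fun s => ?_
  congr 1
  rw [Finset.sum_eq_single (Fin.last d)]
  · have : (EuclideanSpace.single (Fin.last d) (1 : ℝ) : Space d) = ey d := rfl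
    rw [this, secondDiff, height_add_smul_ey, height_sub_smul_ey]
  · intro i _ hi
    have : height (EuclideanSpace.single i (1 : ℝ) : Space d) = 0 := by
      simp [height, Ne.symm hi]
    rw [secondDiff, height_add, height_sub, height_smul, this]
    simp; ring
  · simp

theorem height_quadratic (a b c : ℝ) (z : Space d) :
    HasPointLaplacian (fun w => a * height w ^ 2 + b * height w + c) z (2 * a) := by
  refine of_height (h := fun y => a * y ^ 2 + b * y + c) ?_
  refine Tendsto.congr' ?_ tendsto_const_nhds
  filter_upwards [self_mem_nhdsWithin] with s hs
  have hs' : s ≠ 0 := ne_of_gt hs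
  field_simp
  ring

/-- At a local maximum every small second difference is nonpositive, so the limit is too. -/
theorem nonpos_of_isMaxOn {K : Set (Space d)} (hf : HasPointLaplacian f z L)
    (hK : K ∈ 𝓝 z) (hmax : IsMaxOn f K z) : L ≤ 0 := by
  have hle : ∀ᶠ w in 𝓝 z, f w ≤ f z := mem_of_superset hK fun w hw => hmax hw
  have hl : ∀ i : Fin (d + 1), ∀ c : ℝ, ∀ᶠ s : ℝ in 𝓝 0,
      f (z + (c * s) • EuclideanSpace.single i (1 : ℝ)) ≤ f z := fun i c => by
    have hc : Continuous fun s : ℝ =>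
        z + (c * s) • (EuclideanSpace.single i (1 : ℝ) : Space d) := by fun_prop
    have := hc.tendsto 0
    simp only [mul_zero, zero_smul, add_zero] at this
    exact this.eventually hle
  refine le_of_tendsto hf ?_
  filter_upwards [nhdsWithin_le_nhds (eventually_all.2 fun i => hl i 1),
    nhdsWithin_le_nhds (eventually_all.2 fun i => hl i (-1))] with s h1 h2
  refine div_nonpos_of_nonpos_of_nonneg (Finset.sum_nonpos fun i _ => ?_) (sq_nonneg s)
  have h1 := h1 i
  have h2 := h2 i
  rw [one_mul] at h1
  rw [neg_one_mul, neg_smul, ← sub_eq_add_neg] at h2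
  unfold secondDiff
  linarith

end HasPointLaplacian

/-! ### Comparison on compact sets and bounds on the boundary datum. -/

/-- The form in which each comparison is run: interior maximum points are contradictory, and
boundary ones are estimated directly. -/
theorem le_of_forall_isMaxOn_le {K : Set (Space d)} (hK : IsCompact K) {f : Space d → ℝ}
    (hf : ContinuousOn f K) {M : ℝ} (h : ∀ z ∈ K, IsMaxOn f K z → f z ≤ M) :
    ∀ z ∈ K, f z ≤ M := fun z hz => by
  obtain ⟨w, hw, hmax⟩ := hK.exists_isMaxOn ⟨z, hz⟩ hf
  exact (hmax hz).trans (h w hw hmax)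

theorem tendsto_add_smul_ey (z : Space d) :
    Tendsto (fun s : ℝ => z + s • ey d) (𝓝 0) (𝓝 z) := by
  have : Continuous fun s : ℝ => z + s • ey d := by fun_prop
  simpa using this.tendsto 0

theorem eventually_mem_upperHalfBall {z : Space d} (hz : z ∈ flatBall d) :
    ∀ᶠ s : ℝ in 𝓝[>] 0, z + s • ey d ∈ upperHalfBall d := by
  filter_upwards [nhdsWithin_le_nhds ((tendsto_add_smul_ey z).eventually
    (isOpen_ball.mem_nhds hz.1)), self_mem_nhdsWithin] with s h1 h2
  exact ⟨h1, by rw [height_add_smul_ey, hz.2, zero_add]; exact h2⟩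

/-- The part of the closed cap where `φ ≤ 0` is compact and misses the equator, so the height has a
positive minimum there; `K` is a bound for `|φ|` divided by that minimum. -/
theorem exists_forall_nonneg_add_mul_height {φ : Space d → ℝ}
    (hφ : ContinuousOn φ (closedBall 0 1)) (hpos : ∀ z ∈ equator d, 0 < φ z) :
    ∃ K : ℝ, 0 ≤ K ∧ ∀ z ∈ sphere (0 : Space d) 1, 0 ≤ height z → 0 ≤ φ z + K * height z := by
  obtain ⟨M, hM⟩ := (isCompact_closedBall (0 : Space d) 1).exists_bound_of_continuousOn hφ
  let S : Set (Space d) := {z ∈ sphere (0 : Space d) 1 ∩ {z | 0 ≤ height z} | φ z ≤ 0}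
  have hcap : IsCompact (sphere (0 : Space d) 1 ∩ {z | 0 ≤ height z}) :=
    (isCompact_sphere 0 1).inter_right (isClosed_le continuous_const continuous_height)
  have hS : IsCompact S := by
    have hc : ContinuousOn φ (sphere (0 : Space d) 1 ∩ {z | 0 ≤ height z}) :=
      hφ.mono (inter_subset_left.trans sphere_subset_closedBall)
    exact hcap.of_isClosed_subset
      (hc.preimage_isClosed_of_isClosed hcap.isClosed (isClosed_Iic (a := (0 : ℝ)))) inter_subset_left
  rcases S.eq_empty_or_nonempty with h | h
  · refine ⟨0, le_rfl, fun z hz hy => ?_⟩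
    by_contra hc
    have : z ∈ S := ⟨⟨hz, hy⟩, by linarith⟩
    simp [h] at this
  · obtain ⟨w, hw, hmin⟩ := hS.exists_isMinOn h continuous_height.continuousOn
    have hw0 : 0 < height w := lt_of_le_of_ne hw.1.2 fun h0 =>
      (hpos w ⟨hw.1.1, h0.symm⟩).not_ge hw.2
    have hM0 : 0 ≤ M := (norm_nonneg _).trans (hM w (sphere_subset_closedBall hw.1.1))
    refine ⟨M / height w, by positivity, fun z hz hy => ?_⟩
    rcases le_total 0 (φ z) with h1 | h1
    · positivity
    · have h2 : height w ≤ height z := hmin (show z ∈ S from ⟨⟨hz, hy⟩, h1⟩)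
      have h3 := hM z (sphere_subset_closedBall hz)
      rw [Real.norm_eq_abs] at h3
      have h4 : M ≤ M / height w * height z := by
        rw [div_mul_eq_mul_div, le_div_iff₀ hw0]
        exact mul_le_mul_of_nonneg_left h2 hM0
      linarith [neg_abs_le (φ z)]

theorem IsC2Alpha.exists_bounds {α : ℝ≥0} {φ : Space d → ℝ} (hφ : IsC2Alpha α φ) :
    (∃ L : ℝ, 0 ≤ L ∧ ∀ z ∈ closedBall (0 : Space d) 1, ∀ w ∈ closedBall (0 : Space d) 1,
      |φ z - φ w| ≤ L * ‖z - w‖) ∧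
    ∃ A : ℝ, 0 ≤ A ∧ ∀ z ∈ ball (0 : Space d) 1,
      ContDiffAt ℝ 2 φ z ∧ |Laplacian.laplacian φ z| ≤ A := by
  have hφ := hφ.1
  have hu : UniqueDiffOn ℝ (closedBall (0 : Space d) 1) :=
    uniqueDiffOn_convex (convex_closedBall 0 1)
      ⟨0, ball_subset_interior_closedBall (mem_ball_self one_pos)⟩
  have hK := isCompact_closedBall (0 : Space d) 1
  constructor
  · obtain ⟨L, hL⟩ := hK.exists_bound_of_continuousOn
      (hφ.continuousOn_fderivWithin hu (by norm_num))
    refine ⟨max L 0, le_max_right _ _, fun z hz w hw => ?_⟩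
    exact (convex_closedBall (0 : Space d) 1).norm_image_sub_le_of_norm_fderivWithin_le
      (hφ.differentiableOn (by norm_num)) (fun x hx => (hL x hx).trans (le_max_left _ _)) hw hz
  · obtain ⟨A, hA⟩ := hK.exists_bound_of_continuousOn
      (hφ.continuousOn_iteratedFDerivWithin (m := 2) le_rfl hu)
    have hA0 : 0 ≤ A := (norm_nonneg _).trans (hA 0 (mem_closedBall_self zero_le_one))
    refine ⟨(d + 1) * A, by positivity, fun z hz => ?_⟩
    have hc : ContDiffAt ℝ 2 φ z := hφ.contDiffAt (closedBall_mem_nhds_of_mem hz)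
    refine ⟨hc, ?_⟩
    rw [InnerProductSpace.laplacian_eq_iteratedFDeriv_orthonormalBasis φ
      (EuclideanSpace.basisFun (Fin (d + 1)) ℝ)]
    refine (Finset.abs_sum_le_sum_abs _ _).trans ?_
    have h1 : ∀ i ∈ Finset.univ, |iteratedFDeriv ℝ 2 φ z
        ![EuclideanSpace.basisFun (Fin (d + 1)) ℝ i, EuclideanSpace.basisFun (Fin (d + 1)) ℝ i]|
        ≤ A := fun i _ => by
      rw [← iteratedFDerivWithin_eq_iteratedFDeriv hu hc (ball_subset_closedBall hz)]
      refine ((iteratedFDerivWithin ℝ 2 φ (closedBall 0 1) z).le_opNorm _).trans ?_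
      simpa [Fin.prod_univ_two] using hA z (ball_subset_closedBall hz)
    refine (Finset.sum_le_sum h1).trans (le_of_eq ?_)
    simp

theorem mem_cases {z : Space d} (hz : z ∈ closedUpperHalfBall d) :
    z ∈ upperHalfBall d ∨ z ∈ flatBall d ∨ (z ∈ sphere (0 : Space d) 1 ∧ 0 ≤ height z) := by
  have h1 : ‖z‖ ≤ 1 := by simpa using hz.1
  rcases h1.lt_or_eq with h | h
  · rcases hz.2.lt_or_eq with h0 | h0
    · exact Or.inl ⟨by simpa using h, h0⟩
    · exact Or.inr (Or.inl ⟨by simpa using h, h0.symm⟩)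
  · exact Or.inr (Or.inr ⟨by simpa using h, hz.2⟩)

theorem closedUpperHalfBall_mem_nhds {z : Space d} (hz : z ∈ upperHalfBall d) :
    closedUpperHalfBall d ∈ 𝓝 z :=
  mem_of_superset (isOpen_upperHalfBall.mem_nhds hz) upperHalfBall_subset

theorem height_le_one {z : Space d} (hz : ‖z‖ ^ 2 ≤ 1) : height z ≤ 1 :=
  (le_abs_self _).trans ((height_le_norm z).trans ((sq_le_one_iff₀ (norm_nonneg z)).1 hz))

/-! ### Boundary slopes, the penalization bound and the barrier. -/

namespace IsSolution

variable {φ u : Space d → ℝ} {b : ℝ → ℝ}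

/-- A limit of the derivative from inside, together with continuity at the endpoint, gives the
one-sided derivative at the endpoint. -/
theorem tendsto_slope (hu : IsSolution φ b u) {z : Space d} (hz : z ∈ flatBall d) :
    Tendsto (fun s : ℝ => (u (z + s • ey d) - u z) / s) (𝓝[>] 0) (𝓝 (b (u z))) := by
  have hev := eventually_mem_upperHalfBall hz
  have hder : ∀ s : ℝ, deriv (fun s : ℝ => u (z + s • ey d)) s = dy u (z + s • ey d) := fun s => by
    have := deriv_comp_const_add (fun s : ℝ => u (z + s • ey d)) s 0
    rw [add_zero] at this
    rw [← this, dy, lineDeriv]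
    congr 1
    ext t
    rw [add_smul, add_assoc]
  have h0 : u z = u (z + (0 : ℝ) • ey d) := by rw [zero_smul, add_zero]
  have hmain : HasDerivWithinAt (fun s : ℝ => u (z + s • ey d)) (b (u z)) (Ici 0) 0 := by
    refine hasDerivWithinAt_Ici_of_tendsto_deriv
      (s := {s : ℝ | z + s • ey d ∈ upperHalfBall d}) ?_ ?_ hev ?_
    · intro s hs
      have h1 : DifferentiableAt ℝ u (z + s • ey d) :=
        (hu.harmonic _ hs).1.differentiableAt (by norm_num)
      have h2 : DifferentiableAt ℝ (fun s : ℝ => z + s • ey d) s := by fun_prop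
      exact (DifferentiableAt.comp s h1 h2).differentiableWithinAt
    · have h1 := hu.continuousOn z (flatBall_subset hz)
      refine Tendsto.comp (f := fun s : ℝ => z + s • ey d) (y := 𝓝[closedUpperHalfBall d] z)
        (by change Tendsto u _ (𝓝 (u (z + (0 : ℝ) • ey d))); rwa [← h0]) ?_
      exact tendsto_nhdsWithin_iff.2 ⟨(tendsto_add_smul_ey z).mono_left nhdsWithin_le_nhds,
        eventually_mem_nhdsWithin.mono fun s hs => upperHalfBall_subset hs⟩
    · simp only [hder]
      exact (hu.neumann z hz).comp (tendsto_nhdsWithin_iff.2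
        ⟨(tendsto_add_smul_ey z).mono_left nhdsWithin_le_nhds, hev⟩)
  have := (hasDerivWithinAt_iff_tendsto_slope.1 hmain)
  rw [Ici_sdiff_left] at this
  refine this.congr fun s => ?_
  simp [slope_def_field]

theorem eq_on_cap (hu : IsSolution φ b u) (hφ : ContinuousOn φ (closedBall 0 1)) {z : Space d}
    (hz : z ∈ sphere (0 : Space d) 1) (hy : 0 ≤ height z) : u z = φ z := by
  rcases hy.lt_or_eq with h | h
  · exact hu.dirichlet z ⟨hz, h⟩
  have hz1 : ‖z‖ = 1 := by simpa using hz
  -- The Dirichlet condition covers only `y > 0`; an equatorial point is approached along a great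
  -- circle towards the pole.
  let p : ℝ → Space d := fun s => √(1 - s ^ 2) • z + s • ey d
  have hp : Tendsto p (𝓝[>] 0) (𝓝 z) := by
    have : Continuous p := by fun_prop
    have := this.tendsto 0
    simp only [p] at this
    simpa using this.mono_left nhdsWithin_le_nhds
  have hcap : ∀ᶠ s in 𝓝[>] (0 : ℝ), p s ∈ upperCap d := by
    filter_upwards [self_mem_nhdsWithin, nhdsWithin_le_nhds (eventually_lt_nhds zero_lt_one)]
      with s hs hs1
    have hs0 : 0 < s := hs
    constructor
    · rw [mem_sphere_zero_iff_norm, ← sq_eq_sq₀ (norm_nonneg _) zero_le_one,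
        norm_sq_add_smul_ey, height_smul, ← h, norm_smul, hz1, mul_one, Real.norm_eq_abs, sq_abs,
        Real.sq_sqrt (by nlinarith)]
      ring
    · rw [height_add_smul_ey, height_smul, ← h]; simpa using hs0
  have h1 : Tendsto (fun s => u (p s)) (𝓝[>] 0) (𝓝 (u z)) :=
    (hu.continuousOn z ⟨sphere_subset_closedBall hz, hy⟩).tendsto.comp (tendsto_nhdsWithin_iff.2
      ⟨hp, hcap.mono fun s hs => ⟨sphere_subset_closedBall hs.1, hs.2.le⟩⟩)
  have h2 : Tendsto (fun s => φ (p s)) (𝓝[>] 0) (𝓝 (φ z)) :=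
    (hφ z (sphere_subset_closedBall hz)).tendsto.comp (tendsto_nhdsWithin_iff.2
      ⟨hp, hcap.mono fun s hs => sphere_subset_closedBall hs.1⟩)
  exact tendsto_nhds_unique (h1.congr' (hcap.mono fun s hs => hu.dirichlet _ hs)) h2

/-- By monotonicity only the flat minimum of `u` matters. If it is negative, `u w - K y` touches `u`
from below there, and comparing slopes bounds `b`. -/
theorem neg_le_penalization (hu : IsSolution φ b u) (hφ : ContinuousOn φ (closedBall 0 1))
    (hpos : ∀ z ∈ equator d, 0 < φ z) {K : ℝ} (hK0 : 0 ≤ K)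
    (hK : ∀ z ∈ sphere (0 : Space d) 1, 0 ≤ height z → 0 ≤ φ z + K * height z)
    (hb : Monotone b) (hb0 : ∀ t, 0 ≤ t → b t = 0) :
    ∀ z ∈ flatBall d, -K ≤ b (u z) := by
  intro z hz
  have hD : IsCompact (closedUpperHalfBall d ∩ {z | height z = 0}) :=
    isCompact_closedUpperHalfBall.inter_right (isClosed_eq continuous_height continuous_const)
  obtain ⟨w, hw, hmin⟩ := hD.exists_isMinOn ⟨z, flatBall_subset hz, hz.2⟩
    (hu.continuousOn.mono inter_subset_left)
  have hmz : u w ≤ u z := hmin ⟨flatBall_subset hz, hz.2⟩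
  rcases le_or_gt 0 (u w) with h0 | h0
  · rw [hb0 _ (h0.trans hmz)]; linarith
  have hwf : w ∈ flatBall d := by
    rcases mem_cases hw.1 with h | h | h
    · exact absurd hw.2 h.2.ne'
    · exact h
    · have := hpos w ⟨h.1, hw.2⟩
      rw [← hu.eq_on_cap hφ h.1 h.2] at this
      linarith
  have hkey : ∀ x ∈ closedUpperHalfBall d, u w - K * height x ≤ u x := by
    intro x hx
    refine le_of_forall_pos_le_add fun η hη => ?_
    -- The term `η y²` makes the Laplacian strictly positive, excluding interior maxima; it costs at
    -- most `η` since `y ≤ 1`.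
    let f : Space d → ℝ := fun x => (-1) * u x + (η * height x ^ 2 + (-K) * height x + u w)
    have hf : ContinuousOn f (closedUpperHalfBall d) := by
      have := continuous_height (d := d)
      exact (continuousOn_const.mul hu.continuousOn).add (by fun_prop)
    have hyb : ∀ x ∈ closedUpperHalfBall d, η * height x ^ 2 ≤ η := fun x hx => by
      exact mul_le_of_le_one_right hη.le
        (pow_le_one₀ hx.2 (height_le_one (mem_closedBall_zero_iff_sq.1 hx.1)))
    have := le_of_forall_isMaxOn_le isCompact_closedUpperHalfBall hf (M := η) ?_ x hx
    · have h2 : 0 ≤ η * height x ^ 2 := by positivity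
      simp only [f] at this
      linarith
    intro y hy hmax
    have hyb := hyb y hy
    rcases mem_cases hy with h | h | h
    · exfalso
      have := (((HasPointLaplacian.of_harmonicAt (hu.harmonic y h)).const_mul (-1)).add
        (HasPointLaplacian.height_quadratic η (-K) (u w) y)).nonpos_of_isMaxOn
        (closedUpperHalfBall_mem_nhds h) hmax
      linarith
    · have : u w ≤ u y := hmin ⟨hy, h.2⟩
      simp only [f, h.2]
      simp
      linarith
    · have h1 := hK y h.1 h.2
      rw [← hu.eq_on_cap hφ h.1 h.2] at h1
      simp only [f]
      linarith
  refine le_trans ?_ (hb hmz)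
  refine ge_of_tendsto (hu.tendsto_slope hwf) ?_
  filter_upwards [eventually_mem_upperHalfBall hwf, self_mem_nhdsWithin] with s hs hs0
  have hs0 : 0 < s := hs0
  have := hkey _ (upperHalfBall_subset hs)
  rw [height_add_smul_ey, hwf.2, zero_add] at this
  rw [le_div_iff₀ hs0]
  linarith

/-- The difference between a solution and its boundary datum is controlled by the supersolutions
`(r + (1 - |x|²) / r) / 2 - y`, whose infimum over `r` is the vertical distance to the sphere. -/
theorem abs_sub_le_barrier (hd : 1 ≤ d) (hu : IsSolution φ b u)
    (hφ : ContinuousOn φ (closedBall 0 1)) {K L A : ℝ} (hK0 : 0 ≤ K) (hL0 : 0 ≤ L) (hA0 : 0 ≤ A)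
    (hL : ∀ z ∈ closedBall (0 : Space d) 1, ∀ w ∈ closedBall (0 : Space d) 1,
      |φ z - φ w| ≤ L * ‖z - w‖)
    (hA : ∀ z ∈ ball (0 : Space d) 1, ContDiffAt ℝ 2 φ z ∧ |Laplacian.laplacian φ z| ≤ A)
    (hb : ∀ z ∈ flatBall d, |b (u z)| ≤ K) {r : ℝ} (hr : 0 < r) (hr1 : r ≤ 1)
    {z : Space d} (hz : z ∈ closedUpperHalfBall d) :
    |u z - φ z| ≤ (A + K + L) * ((r + (1 - ‖z‖ ^ 2 + height z ^ 2) / r) / 2 - height z) := by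
  set C := A + K + L with hC
  have hC0 : 0 ≤ C := by positivity
  have key : ∀ σ : ℝ, |σ| = 1 → σ * (u z - φ z) ≤
      C * ((r + (1 - ‖z‖ ^ 2 + height z ^ 2) / r) / 2 - height z) := by
    intro σ hσ
    refine le_of_forall_pos_le_add fun η' hη' => ?_
    obtain ⟨η, hη, rfl⟩ : ∃ η, 0 < η ∧ 2 * η = η' := ⟨η' / 2, by positivity, by ring⟩
    -- This is `σ (u - φ)` minus the barrier plus `η (y² + y)`, expanded so that its Laplacian is
    -- read off termwise. The `η y²` gives strictness inside, the `η y` gives strictness of the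
    -- slope on the flat part.
    let f : Space d → ℝ := fun x => (σ * u x + (-σ) * φ x) + (C / (2 * r) * ‖x‖ ^ 2 +
      ((η - C / (2 * r)) * height x ^ 2 + (C + η) * height x + (-(C * r / 2) - C / (2 * r))))
    have hfe : ∀ x, f x = σ * (u x - φ x) -
        C * ((r + (1 - ‖x‖ ^ 2 + height x ^ 2) / r) / 2 - height x) +
        η * (height x ^ 2 + height x) := fun x => by
      simp only [f]; field_simp; ring
    have hf : ContinuousOn f (closedUpperHalfBall d) := by
      have := continuous_height (d := d)
      exact ((continuousOn_const.mul hu.continuousOn).add (continuousOn_const.mul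
        (hφ.mono fun x hx => hx.1))).add (by fun_prop)
    have hfz := le_of_forall_isMaxOn_le isCompact_closedUpperHalfBall hf (M := 2 * η) ?_ z hz
    · rw [hfe] at hfz
      have : 0 ≤ η * (height z ^ 2 + height z) := mul_nonneg hη.le (by have := hz.2; positivity)
      linarith
    intro x hx hmax
    rcases mem_cases hx with h | h | h
    · exfalso
      have hlap := ((((HasPointLaplacian.of_harmonicAt (hu.harmonic x h)).const_mul σ).add
        ((HasPointLaplacian.of_contDiffAt (hA x h.1).1).const_mul (-σ))).add
        (((HasPointLaplacian.norm_sq x).const_mul (C / (2 * r))).add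
        (HasPointLaplacian.height_quadratic (η - C / (2 * r)) (C + η)
          (-(C * r / 2) - C / (2 * r)) x))).nonpos_of_isMaxOn
        (closedUpperHalfBall_mem_nhds h) hmax
      have h1 : |(-σ) * Laplacian.laplacian φ x| ≤ A := by
        rw [abs_mul, abs_neg, hσ, one_mul]; exact (hA x h.1).2
      -- The quadratic part depends only on the `d` horizontal variables, so its Laplacian is `C d /
      -- r`; it absorbs the bound `A` because `d ≥ 1` and `r ≤ 1`.
      have h2 : C ≤ C / (2 * r) * (2 * (d + 1)) - 2 * (C / (2 * r)) := by
        have hd' : (1 : ℝ) ≤ d := by exact_mod_cast hd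
        have : C / (2 * r) * (2 * (d + 1)) - 2 * (C / (2 * r)) = C * d / r := by
          field_simp; ring
        rw [this, le_div_iff₀ hr]
        nlinarith
      linarith [neg_abs_le ((-σ) * Laplacian.laplacian φ x)]
    · exfalso
      have hlim := (hu.tendsto_slope h).const_mul σ
      -- At a flat maximum the vertical slope of `f` is nonpositive, while `C = A + K + L` outweighs
      -- the slopes of `u` and `φ`.
      have hle : σ * b (u x) ≤ L - C - η := by
        refine le_of_tendsto hlim ?_
        filter_upwards [eventually_mem_upperHalfBall h, self_mem_nhdsWithin] with s hs hs0
        have hs0 : 0 < s := hs0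
        have h1 : f (x + s • ey d) ≤ f x := hmax (upperHalfBall_subset hs)
        rw [hfe, hfe, norm_sq_add_smul_ey, height_add_smul_ey, h.2] at h1
        have h2 := hL _ (upperHalfBall_subset hs).1 _ hx.1
        rw [add_sub_cancel_left, norm_smul, norm_ey, mul_one, Real.norm_of_nonneg hs0.le] at h2
        have h3 : |(-σ) * (φ (x + s • ey d) - φ x)| ≤ L * s := by
          rw [abs_mul, abs_neg, hσ, one_mul]; exact h2
        have h4 := neg_abs_le ((-σ) * (φ (x + s • ey d) - φ x))
        rw [← mul_div_assoc, div_le_iff₀ hs0]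
        have h5 : 0 ≤ η * s ^ 2 := by positivity
        have h6 : (1 - (‖x‖ ^ 2 + 2 * s * 0 + s ^ 2) + (0 + s) ^ 2) = 1 - ‖x‖ ^ 2 + 0 ^ 2 := by ring
        rw [h6] at h1
        nlinarith
      have h1 : |σ * b (u x)| ≤ K := by rw [abs_mul, hσ, one_mul]; exact hb x h
      linarith [neg_abs_le (σ * b (u x))]
    · have hn : ‖x‖ = 1 := by simpa using h.1
      rw [hfe, hu.eq_on_cap hφ h.1 h.2, hn]
      have h1 : 0 ≤ (r + (1 - 1 ^ 2 + height x ^ 2) / r) / 2 - height x := by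
        have : (r + (1 - 1 ^ 2 + height x ^ 2) / r) / 2 - height x =
            (r - height x) ^ 2 / (2 * r) := by field_simp; ring
        rw [this]; positivity
      have h2 := height_le_one (z := x) (by rw [hn]; norm_num)
      have h3 : height x ^ 2 + height x ≤ 2 := by nlinarith [h.2]
      nlinarith [mul_nonneg hC0 h1]
  rw [abs_le']
  constructor
  · simpa using key 1 (by simp)
  · simpa using key (-1) (by simp)

end IsSolution

/-! ### Symmetric vertical differences on the lens. -/

/-- The closed lens of points of the upper half space whose vertical translate by `t` lies in the
closed unit ball. -/
def lens (d : ℕ) (t : ℝ) : Set (Space d) := {z | ‖z + t • ey d‖ ^ 2 ≤ 1 ∧ 0 ≤ height z}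

theorem continuous_norm_sq_add_smul_ey (t : ℝ) :
    Continuous fun z : Space d => ‖z + t • ey d‖ ^ 2 := by
  fun_prop

theorem isCompact_lens (t : ℝ) : IsCompact (lens d t) := by
  refine ((isCompact_closedBall (-(t • ey d)) 1).inter_right
    (isClosed_le continuous_const continuous_height)).of_isClosed_subset ?_ fun z hz => ⟨?_, hz.2⟩
  · exact (isClosed_le (continuous_norm_sq_add_smul_ey t) continuous_const).inter
      (isClosed_le continuous_const continuous_height)
  · rw [mem_closedBall, dist_eq_norm, sub_neg_eq_add]
    exact (sq_le_one_iff₀ (norm_nonneg _)).1 hz.1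

/-- Since `t y ≥ 0` on the lens, the folded lower point stays in the closed ball whenever the upper
one does. -/
theorem norm_sq_fold_sub (z : Space d) (t : ℝ) :
    ‖fold (z - t • ey d)‖ ^ 2 = ‖z + t • ey d‖ ^ 2 - 4 * t * height z := by
  rw [norm_sq_fold, norm_sq_sub_smul_ey, norm_sq_add_smul_ey]; ring

theorem height_fold_sub (z : Space d) (t : ℝ) :
    height (fold (z - t • ey d)) = |height z - t| := by
  rw [height_fold, height_sub_smul_ey]

theorem add_mem_of_mem_lens {t : ℝ} (ht : 0 < t) {z : Space d} (hz : z ∈ lens d t) :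
    z + t • ey d ∈ closedUpperHalfBall d :=
  ⟨mem_closedBall_zero_iff_sq.2 hz.1, by rw [height_add_smul_ey]; linarith [hz.2]⟩

theorem fold_sub_mem_of_mem_lens {t : ℝ} (ht : 0 < t) {z : Space d} (hz : z ∈ lens d t) :
    fold (z - t • ey d) ∈ closedUpperHalfBall d := by
  refine ⟨mem_closedBall_zero_iff_sq.2 ?_, by rw [height_fold]; positivity⟩
  rw [norm_sq_fold_sub]
  have := mul_nonneg ht.le hz.2
  linarith [hz.1]

theorem lens_mem_nhds {t : ℝ} {z : Space d} (h1 : ‖z + t • ey d‖ ^ 2 < 1) (h2 : 0 < height z) :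
    lens d t ∈ 𝓝 z := by
  have ho : IsOpen {z : Space d | ‖z + t • ey d‖ ^ 2 < 1 ∧ 0 < height z} :=
    (isOpen_lt (continuous_norm_sq_add_smul_ey t) continuous_const).inter
      (isOpen_lt continuous_const continuous_height)
  exact mem_of_superset (ho.mem_nhds ⟨h1, h2⟩) fun w hw => ⟨hw.1.le, hw.2.le⟩

theorem flip_sub_smul_ey (z : Space d) (t : ℝ) : flip (z - t • ey d) = flip z + t • ey d := by
  rw [sub_eq_add_neg, ← neg_smul, flip_add_smul, flip_ey]; module

namespace IsSolution

variable {φ u : Space d → ℝ} {b : ℝ → ℝ}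

/-- The symmetric vertical difference of the even reflection of a solution, with a corrector that
is concave across the fold `y = t` of `u (x, |y - t|)`. -/
noncomputable def correctedDiff (u : Space d → ℝ) (σ κ η t : ℝ) (z : Space d) : ℝ :=
  (σ * u (z + t • ey d) + (-σ) * u (fold (z - t • ey d))) +
    (κ * (|height z - t| - height z) + η * height z ^ 2)

/-- Off `y = t` the function has Laplacian `2η > 0`. At `y = t` the reflected term has a slope jump
of at least `-2K`, and the convex kink `κ |y - t|` with `κ = K + η` adds `2κ`; the net jump is
positive, which no maximum allows. -/
theorem not_isMaxOn_correctedDiff (hu : IsSolution φ b u) {K : ℝ}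
    (hb : ∀ z ∈ flatBall d, |b (u z)| ≤ K) {σ : ℝ} (hσ : |σ| = 1) {η t : ℝ} (hη : 0 < η)
    (ht : 0 < t) {z : Space d} (h1 : ‖z + t • ey d‖ ^ 2 < 1) (h2 : 0 < height z) :
    ¬ IsMaxOn (correctedDiff u σ (K + η) η t) (lens d t) z := by
  intro hmax
  have hnhds := lens_mem_nhds h1 h2
  have hζ : z + t • ey d ∈ upperHalfBall d :=
    ⟨mem_ball_zero_iff_sq.2 h1, by rw [height_add_smul_ey]; linarith⟩
  have hpos := mul_pos ht h2
  have hnorm : ‖fold (z - t • ey d)‖ ^ 2 < 1 := by rw [norm_sq_fold_sub]; linarith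
  have hlapζ := (HasPointLaplacian.of_harmonicAt (hu.harmonic _ hζ)).comp_add_right (t • ey d)
  rcases lt_trichotomy (height z) t with h | h | h
  · have hfold : fold (z - t • ey d) = flip z + t • ey d := by
      rw [fold_of_nonpos (by rw [height_sub_smul_ey]; linarith), flip_sub_smul_ey]
    have hw : flip z + t • ey d ∈ upperHalfBall d := by
      rw [← hfold]
      refine ⟨mem_ball_zero_iff_sq.2 hnorm, ?_⟩
      rw [height_fold_sub]
      exact abs_pos.2 (by linarith)
    have hlap := (((hlapζ.const_mul σ).add
      (((HasPointLaplacian.of_harmonicAt (hu.harmonic _ hw)).comp_add_right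
        (t • ey d)).comp_flip.const_mul (-σ))).add
      (HasPointLaplacian.height_quadratic η (-(2 * (K + η))) ((K + η) * t) z)).congr
      (g := correctedDiff u σ (K + η) η t) (by
        filter_upwards [(isOpen_lt continuous_height continuous_const).mem_nhds h] with x hx
        have hx : height x < t := hx
        rw [correctedDiff, fold_of_nonpos (by rw [height_sub_smul_ey]; linarith),
          flip_sub_smul_ey, abs_of_neg (by linarith)]
        ring)
    linarith [hlap.nonpos_of_isMaxOn hnhds hmax]
  · have hz0 : z - t • ey d ∈ flatBall d :=
      ⟨mem_ball_zero_iff_sq.2 (by rwa [norm_sq_fold] at hnorm), by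
        rw [height_sub_smul_ey, h, sub_self]⟩
    -- Second differences are divided here by `s` rather than `s²`: the smooth term then vanishes in
    -- the limit and only the slope jump survives.
    have hsd := (tendsto_secondDiff (hu.harmonic _ hζ).1 (ey d)).mul
      (show Tendsto (fun s : ℝ => s) (𝓝[>] 0) (𝓝 0) from nhdsWithin_le_nhds)
    have hlim := ((hsd.const_mul σ).sub ((hu.tendsto_slope hz0).const_mul (2 * σ))).add_const
      (2 * (K + η))
    have hle := le_of_tendsto (b := 0) hlim (by
      have hneg : Tendsto (fun s : ℝ => z - s • ey d) (𝓝 0) (𝓝 z) := by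
        have : Continuous fun s : ℝ => z - s • ey d := by fun_prop
        simpa using this.tendsto 0
      filter_upwards [self_mem_nhdsWithin,
        nhdsWithin_le_nhds ((tendsto_add_smul_ey z).eventually hnhds),
        nhdsWithin_le_nhds (hneg.eventually hnhds)] with s hs hs1 hs2
      have hs : 0 < s := hs
      have e1 := hmax hs1
      have e2 := hmax hs2
      simp only [mem_ofPred_eq, correctedDiff, height_add_smul_ey, height_sub_smul_ey] at e1 e2
      have f0 : fold (z - t • ey d) = z - t • ey d := fold_of_nonneg hz0.2.ge
      have f1 : fold (z + s • ey d - t • ey d) = z - t • ey d + s • ey d := by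
        rw [add_sub_right_comm]
        exact fold_of_nonneg (by rw [height_add_smul_ey, hz0.2]; linarith)
      have f2 : fold (z - s • ey d - t • ey d) = z - t • ey d + s • ey d := by
        rw [sub_right_comm, fold_of_nonpos (by rw [height_sub_smul_ey, hz0.2]; linarith),
          flip_sub_smul_ey]
        congr 1
        simp [flip, hz0.2]
      rw [f0, f1, h, add_sub_cancel_left, abs_of_pos hs, sub_self, abs_zero] at e1
      rw [f0, f2, h, sub_sub_cancel_left, abs_neg, abs_of_pos hs, sub_self, abs_zero] at e2
      have hs' : s ≠ 0 := hs.ne'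
      have e3 : secondDiff u (z + t • ey d) (s • ey d) =
          u (z + s • ey d + t • ey d) + u (z - s • ey d + t • ey d) - 2 * u (z + t • ey d) := by
        rw [secondDiff, add_right_comm z, add_sub_right_comm z]
      have e4 : σ * (secondDiff u (z + t • ey d) (s • ey d) / s ^ 2 * s) -
          2 * σ * ((u (z - t • ey d + s • ey d) - u (z - t • ey d)) / s) + 2 * (K + η) =
          (σ * secondDiff u (z + t • ey d) (s • ey d) -
          2 * σ * (u (z - t • ey d + s • ey d) - u (z - t • ey d)) + 2 * (K + η) * s) / s := by
        field_simp
      rw [e4, e3]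
      refine div_nonpos_of_nonpos_of_nonneg ?_ hs.le
      have e5 : 0 ≤ η * s ^ 2 := by positivity
      linarith)
    have h3 : |σ * b (u (z - t • ey d))| ≤ K := by
      rw [abs_mul, hσ, one_mul]; exact hb _ hz0
    linarith [le_abs_self (σ * b (u (z - t • ey d)))]
  · have hfold : fold (z - t • ey d) = z + (-t) • ey d := by
      rw [fold_of_nonneg (by rw [height_sub_smul_ey]; linarith), neg_smul, sub_eq_add_neg]
    have hw : z + (-t) • ey d ∈ upperHalfBall d := by
      rw [← hfold]
      refine ⟨mem_ball_zero_iff_sq.2 hnorm, ?_⟩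
      rw [height_fold_sub]
      exact abs_pos.2 (by linarith)
    have hlap := (((hlapζ.const_mul σ).add
      (((HasPointLaplacian.of_harmonicAt (hu.harmonic _ hw)).comp_add_right
        ((-t) • ey d)).const_mul (-σ))).add
      (HasPointLaplacian.height_quadratic η 0 (-((K + η) * t)) z)).congr
      (g := correctedDiff u σ (K + η) η t) (by
        filter_upwards [(isOpen_lt continuous_const continuous_height).mem_nhds h] with x hx
        have hx : t < height x := hx
        rw [correctedDiff, fold_of_nonneg (by rw [height_sub_smul_ey]; linarith),
          neg_smul, ← sub_eq_add_neg, abs_of_pos (by linarith)]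
        ring)
    linarith [hlap.nonpos_of_isMaxOn hnhds hmax]

/-- The spherical boundary contributes `2 (C + L) t`; the corrector contributes `K t` as an upper
bound at the maximum and `K t` again when it is removed at `z`. -/
theorem abs_symmetric_diff_le (hd : 1 ≤ d) (hu : IsSolution φ b u)
    (hφ : ContinuousOn φ (closedBall 0 1)) {K L A : ℝ} (hK0 : 0 ≤ K) (hL0 : 0 ≤ L) (hA0 : 0 ≤ A)
    (hL : ∀ z ∈ closedBall (0 : Space d) 1, ∀ w ∈ closedBall (0 : Space d) 1,
      |φ z - φ w| ≤ L * ‖z - w‖)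
    (hA : ∀ z ∈ ball (0 : Space d) 1, ContDiffAt ℝ 2 φ z ∧ |Laplacian.laplacian φ z| ≤ A)
    (hb : ∀ z ∈ flatBall d, |b (u z)| ≤ K) {t : ℝ} (ht : 0 < t) {z : Space d}
    (hz : z ∈ lens d t) :
    |u (z + t • ey d) - u (fold (z - t • ey d))| ≤ 2 * (A + 2 * K + 2 * L) * t := by
  set C := A + K + L with hC
  have hC0 : 0 ≤ C := by positivity
  have habs : ∀ y : ℝ, |y - t| - y ≤ t ∨ y < 0 := fun y => by
    rcases lt_or_ge y 0 with h | h
    · exact Or.inr h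
    · left
      have : |y - t| ≤ y + t := abs_le.2 ⟨by linarith, by linarith⟩
      linarith
  have key : ∀ σ : ℝ, |σ| = 1 → σ * (u (z + t • ey d) - u (fold (z - t • ey d))) ≤
      2 * (A + 2 * K + 2 * L) * t := by
    intro σ hσ
    refine le_of_forall_pos_le_add fun η' hη' => ?_
    -- The corrector costs `η t` twice, and `η y²` costs at most `η`.
    obtain ⟨η, hη, rfl⟩ : ∃ η, 0 < η ∧ (2 * t + 1) * η = η' :=
      ⟨η' / (2 * t + 1), by positivity, by field_simp⟩
    have hf : ContinuousOn (correctedDiff u σ (K + η) η t) (lens d t) := by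
      have hc := continuous_height (d := d)
      have h1 : ContinuousOn (fun x => u (x + t • ey d)) (lens d t) :=
        hu.continuousOn.comp (by fun_prop) fun x hx => add_mem_of_mem_lens ht hx
      have h2 : ContinuousOn (fun x => u (fold (x - t • ey d))) (lens d t) :=
        hu.continuousOn.comp (continuous_fold.comp (by fun_prop)).continuousOn
          fun x hx => fold_sub_mem_of_mem_lens ht hx
      exact ((continuousOn_const.mul h1).add (continuousOn_const.mul h2)).add (by fun_prop)
    have hfz := le_of_forall_isMaxOn_le (isCompact_lens t) hf
      (M := 2 * (C + L) * t + (K + η) * t + η) ?_ z hz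
    · have h1 : -t ≤ |height z - t| - height z := by
        linarith [le_abs_self (height z - t)]
      have h2 : (K + η) * (-t) ≤ (K + η) * (|height z - t| - height z) :=
        mul_le_mul_of_nonneg_left h1 (by positivity)
      have h3 : 0 ≤ η * height z ^ 2 := by positivity
      simp only [correctedDiff] at hfz
      rw [hC] at hfz
      linarith
    intro x hx hmax
    have hcor : (K + η) * (|height x - t| - height x) ≤ (K + η) * t :=
      mul_le_mul_of_nonneg_left ((habs (height x)).resolve_right hx.2.not_gt) (by positivity)
    have hxt := (add_mem_of_mem_lens ht hx)
    have hle1 : height x + t ≤ 1 := by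
      have := height_le_one hx.1
      rwa [height_add_smul_ey] at this
    have hsq : η * height x ^ 2 ≤ η :=
      mul_le_of_le_one_right hη.le (pow_le_one₀ hx.2 (by linarith))
    rcases hx.2.lt_or_eq with h0 | h0
    · rcases hx.1.lt_or_eq with h1 | h1
      · exact absurd hmax (hu.not_isMaxOn_correctedDiff hb hσ hη ht h1 h0)
      have hw := fold_sub_mem_of_mem_lens ht hx
      have hsph : x + t • ey d ∈ sphere (0 : Space d) 1 := by
        rw [mem_sphere_zero_iff_norm]
        exact (pow_eq_one_iff_of_nonneg (norm_nonneg _) two_ne_zero).1 h1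
      -- The point at height `x_y + t` lies on the sphere, so with `r` equal to that height the
      -- barrier becomes the vertical gap `r - |x_y - t| ≤ 2t`.
      have hbar := hu.abs_sub_le_barrier hd hφ hK0 hL0 hA0 hL hA hb
        (r := height x + t) (by linarith) hle1 hw
      have hr : height x + t ≠ 0 := by positivity
      rw [norm_sq_fold_sub, height_fold_sub, h1, sq_abs,
        show (1 - (1 - 4 * t * height x) + (height x - t) ^ 2) / (height x + t) = height x + t by
          field_simp; ring] at hbar
      have hlip := hL _ hxt.1 _ hw.1
      have hδ : x + t • ey d - fold (x - t • ey d) =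
          (height x + t - |height x - t|) • ey d := by
        rw [fold, height_sub_smul_ey]; module
      have hδ0 : 0 ≤ height x + t - |height x - t| := by
        have : |height x - t| ≤ height x + t := abs_le.2 ⟨by linarith, by linarith⟩
        linarith
      have hδ1 : height x + t - |height x - t| ≤ 2 * t := by linarith [le_abs_self (height x - t)]
      rw [hδ, norm_smul, norm_ey, mul_one, Real.norm_of_nonneg hδ0] at hlip
      have hcap := hu.eq_on_cap hφ hsph hxt.2
      have htot : |σ * (u (x + t • ey d) - u (fold (x - t • ey d)))| ≤ 2 * (C + L) * t := by
        rw [abs_mul, hσ, one_mul, hcap]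
        calc |φ (x + t • ey d) - u (fold (x - t • ey d))|
            = |(φ (x + t • ey d) - φ (fold (x - t • ey d))) -
                (u (fold (x - t • ey d)) - φ (fold (x - t • ey d)))| := by congr 1; ring
          _ ≤ _ := abs_sub _ _
          _ ≤ L * (height x + t - |height x - t|) + C * (height x + t - |height x - t|) := by
              refine add_le_add hlip (hbar.trans (le_of_eq ?_))
              ring
          _ ≤ L * (2 * t) + C * (2 * t) := by gcongr
          _ = _ := by ring
      have := le_abs_self (σ * (u (x + t • ey d) - u (fold (x - t • ey d))))
      simp only [correctedDiff]
      linarith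
    · have hfold : fold (x - t • ey d) = x + t • ey d := by
        rw [fold_of_nonpos (by rw [height_sub_smul_ey]; linarith), flip_sub_smul_ey]
        simp [flip, ← h0]
      have : 0 ≤ 2 * (C + L) * t := by positivity
      simp only [correctedDiff, hfold]
      linarith
  rw [abs_le']
  constructor
  · simpa using key 1 (by simp)
  · simpa using key (-1) (by simp)

/-! ### From differences to the derivative of the even reflection. -/

/-- For `t` below the height of `z` the fold is inactive, and the difference over `t` tends to `2
u_y`. -/
theorem abs_dy_le (hu : IsSolution φ b u) {B : ℝ}
    (hB : ∀ t > 0, ∀ z ∈ lens d t,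
      |u (z + t • ey d) - u (fold (z - t • ey d))| ≤ 2 * B * t) {z : Space d}
    (hz : z ∈ upperHalfBall d) : |dy u z| ≤ B := by
  have hdz : DifferentiableAt ℝ u z := (hu.harmonic z hz).1.differentiableAt (by norm_num)
  have h1 : HasDerivAt (fun s : ℝ => u (z + s • ey d)) (dy u z) 0 :=
    hdz.lineDifferentiableAt.hasLineDerivAt
  have h2 : HasDerivAt (fun s : ℝ => u (z + (-s) • ey d)) (-dy u z) 0 := by
    have h3 : HasDerivAt (fun s : ℝ => u (z + s • ey d)) (dy u z) (-0) := by rwa [neg_zero]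
    have h4 := h3.comp (0 : ℝ) (hasDerivAt_neg (0 : ℝ))
    rw [mul_neg_one] at h4
    exact h4
  have h3 := (h1.sub h2).tendsto_slope_zero_right.abs
  rw [show dy u z - -dy u z = 2 * dy u z by ring, abs_mul, abs_two] at h3
  have : 2 * |dy u z| ≤ 2 * B := by
    refine le_of_tendsto h3 ?_
    filter_upwards [self_mem_nhdsWithin, nhdsWithin_le_nhds (eventually_lt_nhds hz.2),
      nhdsWithin_le_nhds ((tendsto_add_smul_ey z).eventually (isOpen_ball.mem_nhds hz.1))]
      with s hs hsz hball
    have hs : 0 < s := hs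
    have := hB s hs z ⟨(mem_ball_zero_iff_sq.1 hball).le, hz.2.le⟩
    rw [fold_of_nonneg (by rw [height_sub_smul_ey]; linarith)] at this
    simp only [Pi.sub_apply, zero_add, zero_smul, sub_zero, smul_eq_mul, add_zero, sub_self,
      neg_smul, ← sub_eq_add_neg, abs_mul, abs_inv, abs_of_pos hs]
    rw [inv_mul_le_iff₀ hs]
    linarith
  linarith

theorem dy_evenReflection_flip (u : Space d → ℝ) (z : Space d) :
    dy (evenReflection u) (flip z) = -dy (evenReflection u) z := by
  unfold dy lineDeriv
  have h : (fun t : ℝ => evenReflection u (flip z + t • ey d)) =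
      fun t : ℝ => (fun s : ℝ => evenReflection u (z + s • ey d)) (-t) := by
    ext t
    simp only [evenReflection_eq]
    rw [← fold_flip, flip_add_smul, flip_flip, flip_ey, smul_neg, neg_smul]
  rw [h, deriv_comp_neg (fun s : ℝ => evenReflection u (z + s • ey d)), neg_zero]

theorem abs_dy_evenReflection_le {B : ℝ} (hB0 : 0 ≤ B)
    (hB : ∀ z ∈ upperHalfBall d, |dy u z| ≤ B) {z : Space d} (hz : z ∈ ball (0 : Space d) 1) :
    |dy (evenReflection u) z| ≤ B := by
  have hup : ∀ w ∈ upperHalfBall d, |dy (evenReflection u) w| ≤ B := fun w hw => by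
    have : dy (evenReflection u) w = dy u w := by
      unfold dy lineDeriv
      refine Filter.EventuallyEq.deriv_eq ?_
      filter_upwards [(tendsto_add_smul_ey w).eventually
        ((isOpen_lt continuous_const continuous_height).mem_nhds hw.2)] with s hs
      rw [evenReflection_eq, fold_of_nonneg (le_of_lt hs)]
    rw [this]
    exact hB w hw
  rcases lt_trichotomy (height z) 0 with h | h | h
  · have := hup (flip z) ⟨mem_ball_zero_iff_sq.2 (by
      rw [norm_sq_flip]; exact mem_ball_zero_iff_sq.1 hz), by rw [height_flip]; linarith⟩
    rwa [dy_evenReflection_flip, abs_neg] at this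
  -- On the flat part the line derivative equals its own negative, hence is `0`; this also covers a
  -- kink, where the default value of `deriv` is `0`.
  · have h1 := dy_evenReflection_flip u z
    rw [show flip z = z by simp [flip, h]] at h1
    rw [show dy (evenReflection u) z = 0 by linarith, abs_zero]
    exact hB0
  · exact hup z ⟨hz, h⟩

end IsSolution

end PenalizedObstacle

open PenalizedObstacle
theorem lemma2 {d : ℕ} (hd : 1 ≤ d) (α : ℝ≥0) (hα : 0 < α) (hα' : α ≤ 1)
    (φ : Space d → ℝ) (hφ : IsC2Alpha α φ) (hpos : ∀ z ∈ equator d, 0 < φ z) :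
    ∃ C : ℝ≥0, ∀ β : ℝ → ℝ → ℝ, IsAdmissiblePenalization β → ∀ ε > 0, ∀ u : Space d → ℝ,
      IsSolution φ (β ε) u →
        eLpNorm (dy (evenReflection u)) ⊤ (volume.restrict (ball (0 : Space d) 1)) ≤ C := by
  have hc : ContinuousOn φ (closedBall 0 1) := hφ.1.continuousOn
  obtain ⟨⟨L, hL0, hL⟩, A, hA0, hA⟩ := hφ.exists_bounds
  obtain ⟨K, hK0, hK⟩ := exists_forall_nonneg_add_mul_height hc hpos
  have hB0 : 0 ≤ A + 2 * K + 2 * L := by positivity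
  refine ⟨⟨A + 2 * K + 2 * L, hB0⟩, fun β hβ ε hε u hu => ?_⟩
  have hb : ∀ z ∈ flatBall d, |β ε (u z)| ≤ K := fun z hz => abs_le.2
    ⟨hu.neg_le_penalization hc hpos hK0 hK (hβ.monotone ε hε) (hβ.eq_zero ε hε) z hz,
      (hβ.nonpos ε hε _).trans hK0⟩
  have hdy : ∀ z ∈ upperHalfBall d, |dy u z| ≤ A + 2 * K + 2 * L := fun z hz =>
    hu.abs_dy_le (fun t ht w hw =>
      hu.abs_symmetric_diff_le hd hc hK0 hL0 hA0 hL hA hb ht hw) hz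
  rw [eLpNorm_exponent_top]
  refine eLpNormEssSup_le_of_ae_nnnorm_bound ?_
  filter_upwards [ae_restrict_mem measurableSet_ball] with z hz
  exact NNReal.coe_le_coe.1 (IsSolution.abs_dy_evenReflection_le hB0 hdy hz)
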